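/- Let $p$ be a prime number, $e\ge 1$ and $D=p^e$. For $a\in\mathbb C$ let $f_a(z)=az^D+1$. For $n\ge 1$ let $P_n\in\mathbb Z[a]$ be the polynomial $P_n(a)=f_a^{\circ n}(0)$, and let $R_n=\prod_{m\mid n}P_m^{\mu(n/m)}\in\mathbb Z[a]$, where $\mu$ is the Möbius function. For $k\ge 2$, $n\ge 1$ and a divisor $d\ge 2$ of $D$, let $R_{k,n,d}$ be the monic polynomial with simple roots whose roots are exactly the parameters $a\in\mathbb C$ such that (i) $0$ is preperiodic for $f_a$ with preperiod $k$ and period $n$, i.e. $f_a^{\circ k}(0)$ is periodic of exact period $n$ and $f_a^{\circ j}(0)$ is not periodic for $0\le j<k$; and (ii) $f_a^{\circ(k+n-1)}(0)=\omega f_a^{\circ(k-1)}(0)$ for some primitive $d$-th root of unity $\omega\in\mathbb C$. Then: 1. For all $k\ge 2$ and all divisors $d\ge 2$ of $D$, the polynomial $R_{k,1,d}$ has integer coefficients and is irreducible over $\mathbb Q$. 2. More generally, if $n\ge 2$ and the reduction $R_n \bmod p$ is irreducible over $\mathbb F_p$, then for all $k\ge 2$ and all divisors $d\ge 2$ of $D$,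 the polynomial $R_{k,n,d}$ has integer coefficients and is irreducible over $\mathbb Q$. -/

import Mathlib

open Polynomial

noncomputable section

/-- The unicritical family `f_a(z) = a z ^ D + 1`, over an arbitrary commutative ring. -/
def unicritical {A : Type*} [CommRing A] (D : ℕ) (a z : A) : A := a * z ^ D + 1

/-- The point `x` is preperiodic for `f` with preperiod `k` and period `n`: the iterate `f^[k] x` is
periodic, `k` is the least integer with this property, and the cycle on which `x` lands has (exact)
period `n`. -/
def IsPreperiodicWith {S : Type*} (f : S → S) (x : S) (k n : ℕ) : Prop :=
  f^[k] x ∈ Function.periodicPts f ∧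
    (∀ j < k, f^[j] x ∉ Function.periodicPts f) ∧
    Function.minimalPeriod f (f^[k] x) = n

/-- The polynomial `P_n ∈ ℤ[a]` with `P_n(a) = f_a^[n] (0)`; the variable `a` is `X`. -/
def critOrbitPoly (D n : ℕ) : ℤ[X] := (unicritical D (X : ℤ[X]))^[n] 0

/-- The polynomial `R_n = ∏_{m ∣ n} P_m ^ μ(n / m) ∈ ℤ[a]`, written as the quotient of the product of
the factors with exponent `1` by the (monic) product of the factors with exponent `-1`. -/
def periodicPoly (D n : ℕ) : ℤ[X] :=
  (∏ m ∈ n.divisors with ArithmeticFunction.moebius (n / m) = 1, critOrbitPoly D m) /ₘ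
    (∏ m ∈ n.divisors with ArithmeticFunction.moebius (n / m) = -1, critOrbitPoly D m)

/-- The parameters `a ∈ ℂ` for which `0` is preperiodic for `f_a` with preperiod `k` and period `n`, and
`f_a^[k + n - 1] (0) = ω * f_a^[k - 1] (0)` for some primitive `d`-th root of unity `ω`.
(Used for `k ≥ 2` and `n ≥ 1`, so that the subtractions are honest.) -/
def preperiodicParams (D k n d : ℕ) : Set ℂ :=
  {a | IsPreperiodicWith (unicritical D a) 0 k n ∧
    ∃ ω : ℂ, IsPrimitiveRoot ω d ∧
      (unicritical D a)^[k + n - 1] 0 = ω * (unicritical D a)^[k - 1] 0}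

/-- The monic polynomial `R_{k,n,d}` with simple roots, whose roots are the (finitely many) parameters in
`preperiodicParams D k n d`, as a polynomial with complex coefficients. -/
def preperiodicPoly (D k n d : ℕ) : ℂ[X] :=
  ∏ᶠ a ∈ preperiodicParams D k n d, (X - C a)

/-- A complex polynomial has integer coefficients and is irreducible over `ℚ`. -/
def IsIntegralIrreducibleOverRat (F : ℂ[X]) : Prop :=
  ∃ Q : ℤ[X], Q.map (Int.castRingHom ℂ) = F ∧ Irreducible (Q.map (Int.castRingHom ℚ))

end

/-!
Write `l = k - 1` and `d = p ^ (j + 1)`. A parameter of preperiod `k` and period `n` with relation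
`f^[l + n] 0 = ω * f^[l] 0` is a root of the monic integer polynomial
`S_n = Ψ (P_{l + n}, P_l)` (`orbitRelationPoly`), where `Ψ (x, y) = y ^ φ(d) * Φ_d (x / y)` is the
homogeneous cyclotomic form (`cyclotomicForm`). The other roots of `S_n` are the parameters of preperiod
`k` whose period is a proper divisor of `n`, and those for which `P_l` and `P_{l + n}` both vanish
(`exists_mem_preperiodicParams`).

The proof is an Eisenstein argument at the prime `(p, R_n)` of `ℤ[X]`. For `n = 1`, where `R_1 = 1`, the
polynomial `X` takes the place of `R_n`, and `S_1` is an Eisenstein polynomial in the usual sense. In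
general one divides out of `P_{l + n}` and `P_l` the common factor `ρ = R_n` if `n ∣ l` (and `ρ = 1`
otherwise), obtaining `A` and `B`, and considers `S = Ψ (A, B)`.

* As `0` is a critical point, `P_n ^ 2` divides `P_{l + n} - P_l` (`critOrbitPoly_sq_dvd`), so `A = B`
  modulo `R_n`. Therefore `S = Ψ (B, B) = p * B ^ φ(d)` modulo `R_n`, and `B` is a unit modulo
  `(p, R_n)`: hence `S` does not lie in `(p ^ 2, R_n)` (`cyclotomicForm_ne`).
* Therefore at most one irreducible factor of `S` is divisible by `R_n` modulo `p`, and there is one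
  because `R_n` divides `S` modulo `p` (`isIntegralIrreducibleOverRat_of_roots`).
* It remains to see that the parameters in question are exactly the roots of this factor. Modulo `p`,
  `S_n` is a power of `X` times a power of `P_n`, with exponents that do not depend on `n`
  (`reduce_orbitRelationPoly`), `P_n` is squarefree because `X P_n' = P_n - 1`
  (`not_sq_dvd_reduce_critOrbitPoly`), and `S_m ∣ S_n` for `m ∣ n` (`orbitRelationPoly_dvd`). Comparing
  `S_n` with `S_m` for the proper divisors `m` of `n` shows that the minimal polynomial of a parameter of
  period `n` has only the factor `R_n` modulo `p` (`reduce_periodicPoly_dvd_reduce_minpoly`), and that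
  those of the other roots of `S` are prime to `R_n` modulo `p`.

That `R_n` is a polynomial, with simple roots at the parameters for which `0` has exact period `n`, is
Möbius inversion over `ℂ` (`map_periodicPoly`), since the roots of `P_n` are simple.
-/

/-! ### Iterates of the unicritical family over a commutative ring -/

section Iterates

variable {A : Type*} [CommRing A] {D : ℕ}

theorem map_iterate_unicritical {B : Type*} [CommRing B] (φ : A →+* B) (a z : A) (n : ℕ) :
    φ ((unicritical D a)^[n] z) = (unicritical D (φ a))^[n] (φ z) := by
  induction n generalizing z with
  | zero => rfl
  | succ n ih => rw [Function.iterate_succ_apply, Function.iterate_succ_apply, ih]; simp [unicritical]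

theorem map_critOrbitPoly (φ : ℤ[X] →+* A) (n : ℕ) :
    φ (critOrbitPoly D n) = (unicritical D (φ X))^[n] 0 := by
  rw [critOrbitPoly, map_iterate_unicritical, map_zero]

theorem aeval_critOrbitPoly (a : A) (n : ℕ) :
    aeval a (critOrbitPoly D n) = (unicritical D a)^[n] 0 := by
  simpa using map_critOrbitPoly (D := D) (aeval a : ℤ[X] →ₐ[ℤ] A).toRingHom n

theorem sub_dvd_iterate_sub (a u v : A) (n : ℕ) :
    u - v ∣ (unicritical D a)^[n] u - (unicritical D a)^[n] v := by
  induction n with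
  | zero => simp
  | succ n ih =>
    rw [Function.iterate_succ_apply', Function.iterate_succ_apply']
    refine ih.trans ((sub_dvd_pow_sub_pow _ _ D).trans ⟨a, ?_⟩)
    simp only [unicritical]; ring

theorem pow_sub_pow_dvd_iterate_sub (a u v : A) {n : ℕ} (hn : 1 ≤ n) :
    u ^ D - v ^ D ∣ (unicritical D a)^[n] u - (unicritical D a)^[n] v := by
  obtain ⟨n, rfl⟩ : ∃ m, n = m + 1 := ⟨n - 1, by omega⟩
  rw [Function.iterate_succ_apply, Function.iterate_succ_apply]
  refine Dvd.dvd.trans ⟨a, ?_⟩ (sub_dvd_iterate_sub a _ _ n)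
  simp only [unicritical]; ring

/-- If `x` and `f^[m] x` have the same `D`-th power modulo an ideal, then `f^[m] x` is fixed by
`f^[m]` modulo this ideal. -/
theorem pow_sub_pow_dvd_iterate_mul_sub (a x : A) {m : ℕ} (hm : 1 ≤ m) (i : ℕ) :
    ((unicritical D a)^[m] x) ^ D - x ^ D ∣
      (unicritical D a)^[m * (i + 1)] x - (unicritical D a)^[m] x := by
  induction i with
  | zero => simp
  | succ i ih =>
    have h1 : (unicritical D a)^[m * (i + 1 + 1)] x - (unicritical D a)^[m] x =
        ((unicritical D a)^[m * (i + 1)] ((unicritical D a)^[m] x) -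
          (unicritical D a)^[m * (i + 1)] x) +
        ((unicritical D a)^[m * (i + 1)] x - (unicritical D a)^[m] x) := by
      rw [← Function.iterate_add_apply]; ring_nf
    rw [h1]
    exact dvd_add (pow_sub_pow_dvd_iterate_sub a _ _ (Nat.mul_pos hm i.succ_pos)) ih

/-- In characteristic `p` the `D`-th power map is additive, so `f` acts on differences by
`u - v ↦ a (u - v) ^ D`. -/
theorem iterate_sub_of_charP (p e : ℕ) [Fact p.Prime] [CharP A p] (hD : D = p ^ e) (a : A) (n : ℕ) :
    ∃ N : ℕ, ∀ u v : A,
      (unicritical D a)^[n] u - (unicritical D a)^[n] v = a ^ N * (u - v) ^ D ^ n := by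
  induction n with
  | zero => exact ⟨0, by simp⟩
  | succ n ih =>
    obtain ⟨N, hN⟩ := ih
    refine ⟨1 + N * D, fun u v => ?_⟩
    have h1 : ∀ x y : A, unicritical D a x - unicritical D a y = a * (x - y) ^ D := by
      intro x y
      rw [hD, sub_pow_char_pow]; simp only [unicritical]; ring
    rw [Function.iterate_succ_apply', Function.iterate_succ_apply', h1, hN]
    ring

end Iterates

/-! ### The polynomials `P_n` -/

section CritOrbit

variable {D : ℕ}

theorem critOrbitPoly_succ (n : ℕ) :
    critOrbitPoly D (n + 1) = X * critOrbitPoly D n ^ D + 1 := by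
  rw [critOrbitPoly, Function.iterate_succ_apply']; rfl

theorem critOrbitPoly_add (m n : ℕ) :
    critOrbitPoly D (m + n) = (unicritical D X)^[m] (critOrbitPoly D n) := by
  rw [critOrbitPoly, Function.iterate_add_apply]; rfl

theorem X_dvd_critOrbitPoly_sub_one {n : ℕ} (hn : 1 ≤ n) : X ∣ critOrbitPoly D n - 1 := by
  obtain ⟨n, rfl⟩ : ∃ m, n = m + 1 := ⟨n - 1, by omega⟩
  rw [critOrbitPoly_succ]; simp

theorem critOrbitPoly_one (hD : D ≠ 0) : critOrbitPoly D 1 = 1 := by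
  simp [critOrbitPoly, unicritical, hD]

theorem critOrbitPoly_natDegree_succ (hD : 2 ≤ D) (n : ℕ) :
    (critOrbitPoly D (n + 1)).Monic ∧
      (critOrbitPoly D (n + 2)).natDegree = D * (critOrbitPoly D (n + 1)).natDegree + 1 := by
  have step : ∀ q : ℤ[X], q.Monic → (X * q ^ D + 1).Monic ∧
      (X * q ^ D + 1).natDegree = D * q.natDegree + 1 := by
    intro q hq
    have hm : (X * q ^ D).Monic := monic_X.mul (hq.pow D)
    have hd : (X * q ^ D).natDegree = D * q.natDegree + 1 := by
      rw [monic_X.natDegree_mul (hq.pow D), hq.natDegree_pow, natDegree_X]; ring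
    have hlt : (1 : ℤ[X]).degree < (X * q ^ D).degree := by
      rw [degree_one, degree_eq_natDegree hm.ne_zero, hd]
      exact_mod_cast Nat.succ_pos _
    refine ⟨hm.add_of_left hlt, ?_⟩
    rw [natDegree_add_eq_left_of_degree_lt hlt, hd]
  have hmon : ∀ n, (critOrbitPoly D (n + 1)).Monic := by
    intro n
    induction n with
    | zero => rw [critOrbitPoly_one (by omega)]; exact monic_one
    | succ n ih => rw [critOrbitPoly_succ]; exact (step _ ih).1
  refine ⟨hmon n, ?_⟩
  rw [critOrbitPoly_succ (n + 1)]
  exact (step _ (hmon n)).2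

theorem critOrbitPoly_monic (hD : 2 ≤ D) {n : ℕ} (hn : 1 ≤ n) : (critOrbitPoly D n).Monic := by
  obtain ⟨n, rfl⟩ : ∃ m, n = m + 1 := ⟨n - 1, by omega⟩
  exact (critOrbitPoly_natDegree_succ hD n).1

theorem critOrbitPoly_natDegree_lt (hD : 2 ≤ D) {m n : ℕ} (hm : 1 ≤ m) (hmn : m < n) :
    (critOrbitPoly D m).natDegree < (critOrbitPoly D n).natDegree := by
  induction n, hmn using Nat.le_induction with
  | base =>
    obtain ⟨m, rfl⟩ : ∃ k, m = k + 1 := ⟨m - 1, by omega⟩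
    rw [(critOrbitPoly_natDegree_succ hD m).2]
    nlinarith
  | succ n hn ih =>
    obtain ⟨n, rfl⟩ : ∃ k, n = k + 1 := ⟨n - 1, by omega⟩
    rw [(critOrbitPoly_natDegree_succ hD n).2]
    nlinarith

/-- Up to a multiple of `D`, the polynomial `P_n` satisfies the differential equation
`X P' = P - 1`. This is what makes its roots simple, both over `ℂ` and modulo `p`. -/
theorem dvd_X_mul_derivative_critOrbitPoly {n : ℕ} (hn : 1 ≤ n) :
    (D : ℤ[X]) ∣ X * derivative (critOrbitPoly D n) - critOrbitPoly D n + 1 := by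
  obtain ⟨n, rfl⟩ : ∃ m, n = m + 1 := ⟨n - 1, by omega⟩
  refine ⟨X ^ 2 * critOrbitPoly D n ^ (D - 1) * derivative (critOrbitPoly D n), ?_⟩
  rw [critOrbitPoly_succ]
  simp [derivative_pow]
  ring

theorem critOrbitPoly_dvd {m n : ℕ} (h : m ∣ n) : critOrbitPoly D m ∣ critOrbitPoly D n := by
  obtain ⟨i, rfl⟩ := h
  induction i with
  | zero => simp [critOrbitPoly]
  | succ i ih =>
    have h1 := sub_dvd_iterate_sub (D := D) X (critOrbitPoly D m) 0 (m * i)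
    rw [← critOrbitPoly_add, sub_zero] at h1
    change _ ∣ _ - critOrbitPoly D (m * i) at h1
    rw [mul_add, mul_one]
    exact (dvd_sub_left ih).1 h1

/-- As `0` is critical for `f`, the orbit of `P_n` follows that of `0` to second order. -/
theorem critOrbitPoly_sq_dvd (hD : 2 ≤ D) {l : ℕ} (hl : 1 ≤ l) (n : ℕ) :
    critOrbitPoly D n ^ 2 ∣ critOrbitPoly D (l + n) - critOrbitPoly D l := by
  have h1 := pow_sub_pow_dvd_iterate_sub (D := D) X (critOrbitPoly D n) 0 hl
  rw [← critOrbitPoly_add, zero_pow (by omega), sub_zero] at h1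
  exact (pow_dvd_pow _ hD).trans h1

end CritOrbit

/-! ### The homogeneous cyclotomic form of prime power order -/

/-- The homogenisation `y ^ φ(d) * Φ_d (x / y)` of the cyclotomic polynomial of order
`d = p ^ (j + 1)`, written as `∑ i < p, (x ^ p ^ j) ^ i * (y ^ p ^ j) ^ (p - 1 - i)`. -/
def cyclotomicForm {A : Type*} [CommRing A] (p j : ℕ) (x y : A) : A :=
  ∑ i ∈ Finset.range p, (x ^ p ^ j) ^ i * (y ^ p ^ j) ^ (p - 1 - i)

section CyclotomicForm

variable {A : Type*} [CommRing A] {p : ℕ} (j : ℕ)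

theorem map_cyclotomicForm {B : Type*} [CommRing B] (φ : A →+* B) (x y : A) :
    φ (cyclotomicForm p j x y) = cyclotomicForm p j (φ x) (φ y) := by
  simp [cyclotomicForm]

theorem cyclotomicForm_mul_sub (x y : A) :
    cyclotomicForm p j x y * (x ^ p ^ j - y ^ p ^ j) = x ^ p ^ (j + 1) - y ^ p ^ (j + 1) := by
  rw [cyclotomicForm, geom_sum₂_mul, pow_succ, pow_mul, pow_mul]

theorem cyclotomicForm_self (x : A) :
    cyclotomicForm p j x x = p * x ^ (p ^ j * (p - 1)) := by
  rw [cyclotomicForm, geom_sum₂_self, pow_mul]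

theorem cyclotomicForm_mul (c x y : A) :
    cyclotomicForm p j (c * x) (c * y) = c ^ (p ^ j * (p - 1)) * cyclotomicForm p j x y := by
  rw [cyclotomicForm, cyclotomicForm, Finset.mul_sum]
  refine Finset.sum_congr rfl fun i hi => ?_
  have hi' : p - 1 = i + (p - 1 - i) := by have := Finset.mem_range.1 hi; omega
  rw [mul_pow, mul_pow, mul_pow, mul_pow, pow_mul c]
  conv_rhs => rw [hi', pow_add, ← hi']
  ring

theorem sub_dvd_cyclotomicForm_sub (x x' y : A) :
    x - x' ∣ cyclotomicForm p j x y - cyclotomicForm p j x' y := by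
  rw [cyclotomicForm, cyclotomicForm, ← Finset.sum_sub_distrib]
  refine Finset.dvd_sum fun i _ => ?_
  rw [← sub_mul, ← pow_mul, ← pow_mul]
  exact (sub_dvd_pow_sub_pow _ _ _).mul_right _

theorem cyclotomicForm_dvd_pow_sub_pow {D : ℕ} (hd : p ^ (j + 1) ∣ D) (x y : A) :
    cyclotomicForm p j x y ∣ x ^ D - y ^ D := by
  obtain ⟨c, rfl⟩ := hd
  rw [pow_mul, pow_mul]
  exact (Dvd.intro _ (cyclotomicForm_mul_sub j x y)).trans (sub_dvd_pow_sub_pow _ _ c)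

theorem cyclotomicForm_of_charP [IsDomain A] [Fact p.Prime] [CharP A p] (x y : A) :
    cyclotomicForm p j x y = (x - y) ^ (p ^ j * (p - 1)) := by
  have hp : p.Prime := Fact.out
  by_cases h : x = y
  · subst h
    have : 0 < p ^ j * (p - 1) := Nat.mul_pos (pow_pos hp.pos _) (Nat.sub_pos_of_lt hp.one_lt)
    rw [cyclotomicForm_self, CharP.cast_eq_zero, sub_self, zero_mul, zero_pow this.ne']
  · have h1 := cyclotomicForm_mul_sub (p := p) j x y
    rw [← sub_pow_char_pow, ← sub_pow_char_pow] at h1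
    refine mul_right_cancel₀ (pow_ne_zero (p ^ j) (sub_ne_zero.2 h)) (h1.trans ?_)
    rw [← pow_add]
    congr 1
    rw [pow_succ, ← Nat.mul_succ]
    congr 1
    have := hp.pos; omega

theorem cyclotomicForm_monic {x y : ℤ[X]} (hp : 1 ≤ p) (hx : x.Monic)
    (h : y.degree < x.degree) : (cyclotomicForm p j x y).Monic := by
  have hlt : ∀ N : ℕ, N ≠ 0 → (y ^ N).degree < (x ^ N).degree := by
    intro N hN
    rw [degree_pow, degree_pow]
    rcases eq_or_ne y 0 with rfl | hy
    · rw [← degree_pow, ← degree_pow, zero_pow hN, degree_zero]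
      exact bot_lt_iff_ne_bot.2 (degree_ne_bot.2 (pow_ne_zero N hx.ne_zero))
    · rw [degree_eq_natDegree hy, degree_eq_natDegree hx.ne_zero] at h ⊢
      have h' : y.natDegree < x.natDegree := by exact_mod_cast h
      rw [nsmul_eq_mul, nsmul_eq_mul]
      exact_mod_cast Nat.mul_lt_mul_of_pos_left h' (Nat.pos_of_ne_zero hN)
  have hm : ∀ N : ℕ, N ≠ 0 → (x ^ N - y ^ N).Monic := fun N hN =>
    (hx.pow N).sub_of_left (hlt N hN)
  refine Monic.of_mul_monic_right (hm (p ^ j) (by positivity)) ?_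
  rw [cyclotomicForm_mul_sub]
  exact hm _ (by positivity)

/-- Away from `y = 0`, the zeros of the form are the pairs `x = ω y` with `ω` a primitive
`p ^ (j + 1)`-th root of unity. -/
theorem cyclotomicForm_eq_zero_iff {K : Type*} [Field K] [CharZero K] (hp : p.Prime) (x : K) {y : K}
    (hy : y ≠ 0) :
    cyclotomicForm p j x y = 0 ↔ ∃ ω : K, IsPrimitiveRoot ω (p ^ (j + 1)) ∧ x = ω * y := by
  have : Fact p.Prime := ⟨hp⟩
  have hp0 : (p : K) ≠ 0 := Nat.cast_ne_zero.2 hp.ne_zero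
  constructor
  · intro h
    refine ⟨x / y, ?_, (div_mul_cancel₀ _ hy).symm⟩
    obtain ⟨w, rfl⟩ : ∃ w, x = y * w := ⟨x / y, (mul_div_cancel₀ _ hy).symm⟩
    rw [mul_div_cancel_left₀ _ hy]
    have h1 : cyclotomicForm p j w 1 = 0 := by
      have := cyclotomicForm_mul (p := p) j y w 1
      rw [mul_one, h] at this
      exact (mul_eq_zero.1 this.symm).resolve_left (pow_ne_zero _ hy)
    have h2 := cyclotomicForm_mul_sub (p := p) j w 1
    rw [h1, zero_mul, one_pow, eq_comm, sub_eq_zero] at h2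
    have h3 : w ^ p ^ j ≠ 1 := by
      intro h3
      simp [cyclotomicForm, h3, hp0] at h1
    rw [← orderOf_eq_prime_pow h3 h2]
    exact IsPrimitiveRoot.orderOf w
  · rintro ⟨w, hw, rfl⟩
    have h2 := cyclotomicForm_mul_sub (p := p) j (w * y) y
    rw [mul_pow, mul_pow, hw.pow_eq_one, one_mul, sub_self] at h2
    refine (mul_eq_zero.1 h2).resolve_right ?_
    have h3 : w ^ p ^ j ≠ 1 :=
      hw.pow_ne_one_of_pos_of_lt (pow_pos hp.pos _).ne' (Nat.pow_lt_pow_right hp.one_lt j.lt_succ_self)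
    rw [← sub_one_mul]
    exact mul_ne_zero (sub_ne_zero.2 h3) (pow_ne_zero _ hy)

/-- If `m ∣ n`, then modulo `f^[m] x ^ D - x ^ D` the points `f^[n] x` and `f^[m] x` agree;
hence the forms are divisible one by the other. -/
theorem cyclotomicForm_iterate_dvd {D : ℕ} (hd : p ^ (j + 1) ∣ D) (a x : A) {m n : ℕ} (hm : 1 ≤ m)
    (hn : 1 ≤ n) (h : m ∣ n) :
    cyclotomicForm p j ((unicritical D a)^[m] x) x ∣
      cyclotomicForm p j ((unicritical D a)^[n] x) x := by
  obtain ⟨i, rfl⟩ := h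
  obtain ⟨i, rfl⟩ : ∃ k, i = k + 1 := ⟨i - 1, by have := Nat.pos_of_mul_pos_left hn; omega⟩
  refine (dvd_sub_left (dvd_refl _)).1 ?_
  refine (cyclotomicForm_dvd_pow_sub_pow j hd _ _).trans ?_
  exact (pow_sub_pow_dvd_iterate_mul_sub a x hm i).trans (sub_dvd_cyclotomicForm_sub j _ _ _)

end CyclotomicForm

/-! ### Preperiodic parameters as roots -/

/-- The polynomial `S_{k,n,d} ∈ ℤ[a]` with `k = l + 1` and `d = p ^ (j + 1)`: its roots are the
parameters with `f^[k + n - 1] 0 = ω * f^[k - 1] 0` for a primitive `d`-th root of unity `ω`. -/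
noncomputable def orbitRelationPoly (D p j l n : ℕ) : ℤ[X] :=
  cyclotomicForm p j (critOrbitPoly D (l + n)) (critOrbitPoly D l)

section Params

variable {D p j l : ℕ}

theorem orbitRelationPoly_dvd (hd : p ^ (j + 1) ∣ D) {m n : ℕ} (hm : 1 ≤ m) (hn : 1 ≤ n)
    (h : m ∣ n) : orbitRelationPoly D p j l m ∣ orbitRelationPoly D p j l n := by
  rw [orbitRelationPoly, orbitRelationPoly, add_comm l, add_comm l, critOrbitPoly_add,
    critOrbitPoly_add]
  exact cyclotomicForm_iterate_dvd j hd X _ hm hn h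

theorem orbitRelationPoly_monic (hD : 2 ≤ D) (hp : 1 ≤ p) {n : ℕ} (hl : 1 ≤ l) (hn : 1 ≤ n) :
    (orbitRelationPoly D p j l n).Monic := by
  refine cyclotomicForm_monic j hp (critOrbitPoly_monic hD (by omega)) ?_
  exact degree_lt_degree (critOrbitPoly_natDegree_lt hD hl (by omega))

theorem aeval_orbitRelationPoly (b : ℂ) (n : ℕ) :
    aeval b (orbitRelationPoly D p j l n) =
      cyclotomicForm p j ((unicritical D b)^[l + n] 0) ((unicritical D b)^[l] 0) := by
  rw [← aeval_critOrbitPoly, ← aeval_critOrbitPoly]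
  exact map_cyclotomicForm j (aeval b : ℤ[X] →ₐ[ℤ] ℂ).toRingHom _ _

theorem iterate_eq_of_orbitRelation (hd : p ^ (j + 1) ∣ D) {b : ℂ} {n : ℕ}
    (h : aeval b (orbitRelationPoly D p j l n) = 0) :
    (unicritical D b)^[l + 1 + n] 0 = (unicritical D b)^[l + 1] 0 := by
  rw [aeval_orbitRelationPoly] at h
  have h1 := cyclotomicForm_dvd_pow_sub_pow j hd ((unicritical D b)^[l + n] 0)
    ((unicritical D b)^[l] 0)
  rw [h, zero_dvd_iff, sub_eq_zero] at h1
  rw [show l + 1 + n = (l + n) + 1 by omega, Function.iterate_succ_apply',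
    Function.iterate_succ_apply', unicritical, unicritical, h1]

theorem iterate_ne_zero_of_mem_preperiodicParams {b : ℂ} {k n d : ℕ} (hk : 1 ≤ k)
    (hb : b ∈ preperiodicParams D k n d) {m : ℕ} (hm : 1 ≤ m) : (unicritical D b)^[m] 0 ≠ 0 :=
  fun h => hb.1.2.1 0 hk ⟨m, hm, h⟩

theorem aeval_orbitRelationPoly_of_mem (hp : p.Prime) {b : ℂ} {n : ℕ} (hl : 1 ≤ l)
    (hb : b ∈ preperiodicParams D (l + 1) n (p ^ (j + 1))) :
    aeval b (orbitRelationPoly D p j l n) = 0 := by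
  rw [aeval_orbitRelationPoly, cyclotomicForm_eq_zero_iff j hp _
    (iterate_ne_zero_of_mem_preperiodicParams (by omega) hb hl)]
  have h := hb.2
  rwa [show l + 1 + n - 1 = l + n by omega, show l + 1 - 1 = l by omega] at h

theorem aeval_orbitRelationPoly_ne_zero_of_mem (hd : p ^ (j + 1) ∣ D) {b : ℂ} {m n : ℕ}
    (hb : b ∈ preperiodicParams D (l + 1) n (p ^ (j + 1))) (hm : 1 ≤ m) (hmn : m < n) :
    aeval b (orbitRelationPoly D p j l m) ≠ 0 := by
  intro h
  have h1 := iterate_eq_of_orbitRelation hd h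
  rw [add_comm, Function.iterate_add_apply] at h1
  have h2 := Function.IsPeriodicPt.minimalPeriod_le hm h1
  rw [hb.1.2.2] at h2
  omega

/-- A root `b` of `S_{k,n,d}` for which `f^[k - 1] 0 ≠ 0` has preperiod `k` and a period that
divides `n`. -/
theorem exists_mem_preperiodicParams (hp : p.Prime) (hd : p ^ (j + 1) ∣ D) {b : ℂ} {n : ℕ}
    (hn : 1 ≤ n) (h : aeval b (orbitRelationPoly D p j l n) = 0)
    (h0 : (unicritical D b)^[l] 0 ≠ 0) :
    ∃ m, m ∣ n ∧ 1 ≤ m ∧ b ∈ preperiodicParams D (l + 1) m (p ^ (j + 1)) := by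
  have hper : Function.IsPeriodicPt (unicritical D b) n ((unicritical D b)^[l + 1] 0) := by
    have h1 := iterate_eq_of_orbitRelation hd h
    rwa [add_comm, Function.iterate_add_apply] at h1
  have hmp : (unicritical D b)^[l + 1] 0 ∈ Function.periodicPts (unicritical D b) := ⟨n, hn, hper⟩
  obtain ⟨w, hw, hw1⟩ := (cyclotomicForm_eq_zero_iff j hp _ h0).1
    ((aeval_orbitRelationPoly b n).symm.trans h)
  have hw2 : w ≠ 1 := by
    rintro rfl
    have h3 := hw.unique IsPrimitiveRoot.one
    have := Nat.one_lt_pow (Nat.succ_ne_zero j) hp.one_lt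
    exact this.ne' h3
  set m := Function.minimalPeriod (unicritical D b) ((unicritical D b)^[l + 1] 0) with hm
  have hmn : m ∣ n := hper.minimalPeriod_dvd
  have hm1 : 1 ≤ m := Function.minimalPeriod_pos_of_mem_periodicPts hmp
  -- The point `f^[l + m] 0` already lies on the cycle, so that `f^[n]` and `f^[m]` agree there.
  have hcyc : (unicritical D b)^[l + n] 0 = (unicritical D b)^[l + m] 0 := by
    obtain ⟨i, rfl⟩ := hmn
    obtain ⟨i, rfl⟩ : ∃ k, i = k + 1 := ⟨i - 1, by have := Nat.pos_of_mul_pos_left hn; omega⟩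
    have hmper : Function.IsPeriodicPt (unicritical D b) (m * i) ((unicritical D b)^[l + 1] 0) :=
      (Function.isPeriodicPt_minimalPeriod _ _).mul_const i
    rw [show l + m * (i + 1) = (m - 1) + (m * i + (l + 1)) by rw [mul_add]; omega,
      Function.iterate_add_apply, Function.iterate_add_apply _ (m * i), hmper.eq,
      ← Function.iterate_add_apply]
    congr 1; omega
  refine ⟨m, hmn, hm1, ⟨hmp, fun i hi hi' => ?_, hm.symm⟩, w, hw, ?_⟩
  · -- A periodic `f^[i] 0` with `i ≤ l` would make `f^[l] 0` fixed by `f^[n]`.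
    have hl : (unicritical D b)^[l] 0 ∈ Function.periodicPts (unicritical D b) := by
      rw [show l = (l - i) + i by omega, Function.iterate_add_apply]
      obtain ⟨q, hq, hq'⟩ := hi'
      exact ⟨q, hq, hq'.apply_iterate _⟩
    have h4 : Function.IsPeriodicPt (unicritical D b) n ((unicritical D b)^[l] 0) := by
      refine Function.isPeriodicPt_iff_minimalPeriod_dvd.2 ?_
      rw [← Function.minimalPeriod_apply hl, ← Function.iterate_succ_apply' (unicritical D b)]
      exact hmn
    have h5 := h4.eq
    rw [← Function.iterate_add_apply, add_comm n l, hw1] at h5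
    exact hw2 (mul_right_cancel₀ h0 (h5.trans (one_mul _).symm))
  · rw [show l + 1 + m - 1 = l + m by omega, show l + 1 - 1 = l by omega, ← hcyc, hw1]

end Params

/-! ### The polynomials `R_n` -/

section Periodic

variable {D : ℕ}

/-- At a multiple root the congruence `X P' = P - 1 (mod D)` would make `1 / D` an algebraic
integer. -/
theorem aeval_derivative_critOrbitPoly_ne_zero (hD : 2 ≤ D) {n : ℕ} (hn : 1 ≤ n) {b : ℂ}
    (hb : aeval b (critOrbitPoly D n) = 0) : aeval b (derivative (critOrbitPoly D n)) ≠ 0 := by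
  intro h'
  obtain ⟨q, hq⟩ := dvd_X_mul_derivative_critOrbitPoly (D := D) hn
  have h1 := congrArg (aeval b) hq
  simp only [map_add, map_sub, map_mul, hb, h', map_one, map_natCast, mul_zero, sub_zero,
    zero_add] at h1
  have hint : IsIntegral ℤ b := ⟨_, critOrbitPoly_monic hD hn, hb⟩
  have hqi : IsIntegral ℤ (aeval b q) := by
    rw [aeval_eq_sum_range]
    exact IsIntegral.sum _ fun i _ => (hint.pow i).smul _
  have hD0 : (D : ℂ) ≠ 0 := Nat.cast_ne_zero.2 (by omega)
  have hq' : aeval b q = algebraMap ℚ ℂ (1 / D) := by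
    rw [map_div₀, map_one, map_natCast, eq_div_iff hD0, mul_comm, ← h1]
  rw [hq', isIntegral_algebraMap_iff (algebraMap ℚ ℂ).injective,
    IsIntegrallyClosed.isIntegral_iff] at hqi
  obtain ⟨y, hy⟩ := hqi
  have hDq : (D : ℚ) ≠ 0 := Nat.cast_ne_zero.2 (by omega)
  rw [eq_div_iff hDq] at hy
  rw [eq_intCast] at hy
  have hy' : y * (D : ℤ) = 1 := by exact_mod_cast hy
  have := Int.eq_one_or_neg_one_of_mul_eq_one' hy'
  omega

/-- The parameters `b` for which `f_b^[n] 0 = 0`. -/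
noncomputable def centers (D n : ℕ) : Finset ℂ :=
  ((critOrbitPoly D n).map (Int.castRingHom ℂ)).roots.toFinset

theorem eval_map_intCast (q : ℤ[X]) (b : ℂ) : (q.map (Int.castRingHom ℂ)).eval b = aeval b q := by
  rw [eval_map]; rfl

theorem mem_centers (hD : 2 ≤ D) {n : ℕ} (hn : 1 ≤ n) {b : ℂ} :
    b ∈ centers D n ↔ Function.minimalPeriod (unicritical D b) 0 ∣ n := by
  rw [centers, Multiset.mem_toFinset, mem_roots ((critOrbitPoly_monic hD hn).map _).ne_zero, IsRoot,
    eval_map_intCast, aeval_critOrbitPoly]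
  exact Function.isPeriodicPt_iff_minimalPeriod_dvd

theorem map_critOrbitPoly_eq_prod (hD : 2 ≤ D) {n : ℕ} (hn : 1 ≤ n) :
    (critOrbitPoly D n).map (Int.castRingHom ℂ) = ∏ b ∈ centers D n, (X - C b) := by
  set q := (critOrbitPoly D n).map (Int.castRingHom ℂ) with hq
  have hm : q.Monic := (critOrbitPoly_monic hD hn).map _
  have hnd : q.roots.Nodup := by
    rw [Multiset.nodup_iff_count_le_one]
    intro b
    rw [count_roots]
    by_contra! h
    obtain ⟨h1, h2⟩ := (one_lt_rootMultiplicity_iff_isRoot hm.ne_zero).1 h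
    rw [hq, derivative_map, IsRoot, eval_map_intCast] at h2
    rw [hq, IsRoot, eval_map_intCast] at h1
    exact aeval_derivative_critOrbitPoly_ne_zero hD hn h1 h2
  rw [centers, ← hq, Finset.prod, Multiset.toFinset_val, hnd.dedup]
  exact (IsAlgClosed.splits q).eq_prod_roots_of_monic hm

/-- The complex polynomial whose roots, all simple, are the parameters for which `0` has exact
period `n`. -/
noncomputable def exactCenterPoly (D n : ℕ) : ℂ[X] :=
  ∏ b ∈ centers D n with Function.minimalPeriod (unicritical D b) 0 = n, (X - C b)

theorem exactCenterPoly_monic (n : ℕ) : (exactCenterPoly D n).Monic :=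
  monic_prod_X_sub_C _ _

theorem prod_exactCenterPoly (hD : 2 ≤ D) {n : ℕ} (hn : 0 < n) :
    ∏ m ∈ n.divisors, exactCenterPoly D m = (critOrbitPoly D n).map (Int.castRingHom ℂ) := by
  rw [map_critOrbitPoly_eq_prod hD hn, ← Finset.prod_fiberwise_of_maps_to (t := n.divisors)
    (g := fun b : ℂ => Function.minimalPeriod (unicritical D b) 0)
    (fun b hb => Nat.mem_divisors.2 ⟨(mem_centers hD hn).1 hb, hn.ne'⟩)]
  refine Finset.prod_congr rfl fun m hm => ?_
  have hmn := Nat.dvd_of_mem_divisors hm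
  rw [exactCenterPoly]
  congr 1
  ext b
  simp only [Finset.mem_filter, and_congr_left_iff]
  rintro rfl
  rw [mem_centers hD hn, mem_centers hD (Nat.pos_of_dvd_of_pos hmn hn)]
  exact ⟨fun _ => hmn, fun _ => dvd_rfl⟩

/-- The product of the factors with exponent `-1` in the definition of `R_n`. -/
noncomputable def periodicDenom (D n : ℕ) : ℤ[X] :=
  ∏ m ∈ n.divisors with ArithmeticFunction.moebius (n / m) = -1, critOrbitPoly D m

/-- The product of the factors with exponent `1` in the definition of `R_n`. -/
noncomputable def periodicNum (D n : ℕ) : ℤ[X] :=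
  ∏ m ∈ n.divisors with ArithmeticFunction.moebius (n / m) = 1, critOrbitPoly D m

theorem periodicDenom_monic (hD : 2 ≤ D) (n : ℕ) : (periodicDenom D n).Monic :=
  monic_prod_of_monic _ _ fun _ hm =>
    critOrbitPoly_monic hD (Nat.pos_of_mem_divisors (Finset.mem_filter.1 hm).1)

theorem map_periodicNum (hD : 2 ≤ D) {n : ℕ} (hn : 0 < n) :
    (periodicNum D n).map (Int.castRingHom ℂ) =
      (periodicDenom D n).map (Int.castRingHom ℂ) * exactCenterPoly D n := by
  have hinj := IsFractionRing.injective ℂ[X] (RatFunc ℂ)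
  have hne : ∀ q : ℂ[X], q.Monic → algebraMap ℂ[X] (RatFunc ℂ) q ≠ 0 := fun q hq =>
    (map_ne_zero_iff _ hinj).2 hq.ne_zero
  have hP : ∀ m : ℕ, 0 < m →
      algebraMap ℂ[X] (RatFunc ℂ) ((critOrbitPoly D m).map (Int.castRingHom ℂ)) ≠ 0 := fun m hm =>
    hne _ ((critOrbitPoly_monic hD hm).map _)
  have key := (ArithmeticFunction.prod_eq_iff_prod_pow_moebius_eq_of_nonzero
    (f := fun m => algebraMap ℂ[X] (RatFunc ℂ) (exactCenterPoly D m))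
    (g := fun m => algebraMap ℂ[X] (RatFunc ℂ) ((critOrbitPoly D m).map (Int.castRingHom ℂ)))
    (fun m _ => hne _ (exactCenterPoly_monic m)) hP).1
    (fun m hm => by rw [← map_prod, prod_exactCenterPoly hD hm]) n hn
  rw [Nat.prod_divisorsAntidiagonal' (f := fun x y => algebraMap ℂ[X] (RatFunc ℂ)
    ((critOrbitPoly D y).map (Int.castRingHom ℂ)) ^ ArithmeticFunction.moebius x)] at key
  have hsplit : ∀ (x : RatFunc ℂ) (m : ℕ), x ^ ArithmeticFunction.moebius m =
      (if ArithmeticFunction.moebius m = 1 then x else 1) /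
        (if ArithmeticFunction.moebius m = -1 then x else 1) := by
    intro x m
    rcases ArithmeticFunction.moebius_eq_or m with h | h | h <;> simp [h]
  simp only [hsplit] at key
  rw [Finset.prod_div_distrib, ← Finset.prod_filter, ← Finset.prod_filter, ← map_prod, ← map_prod,
    div_eq_iff] at key
  · apply hinj
    rw [periodicNum, periodicDenom, Polynomial.map_prod, Polynomial.map_prod, key, map_mul, mul_comm]
  · refine hne _ (monic_prod_of_monic _ _ fun m hm => ?_)
    exact (critOrbitPoly_monic hD (Nat.pos_of_mem_divisors (Finset.mem_filter.1 hm).1)).map _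

theorem dvd_of_map_intCast_dvd {x y : ℤ[X]} (hx : x.Monic)
    (h : x.map (Int.castRingHom ℂ) ∣ y.map (Int.castRingHom ℂ)) : x ∣ y :=
  (map_dvd_map _ (RingHom.injective_int _) hx).1 h

theorem periodicDenom_mul_periodicPoly (hD : 2 ≤ D) {n : ℕ} (hn : 0 < n) :
    periodicDenom D n * periodicPoly D n = periodicNum D n := by
  have hm := periodicDenom_monic hD n
  have hdvd : periodicDenom D n ∣ periodicNum D n :=
    dvd_of_map_intCast_dvd hm ⟨_, map_periodicNum hD hn⟩
  have h1 := modByMonic_add_div (periodicNum D n) (periodicDenom D n)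
  rwa [(modByMonic_eq_zero_iff_dvd hm).2 hdvd, zero_add] at h1

theorem map_periodicPoly (hD : 2 ≤ D) {n : ℕ} (hn : 0 < n) :
    (periodicPoly D n).map (Int.castRingHom ℂ) = exactCenterPoly D n := by
  have h := map_periodicNum hD hn
  rw [← periodicDenom_mul_periodicPoly hD hn, Polynomial.map_mul] at h
  exact mul_left_cancel₀ ((periodicDenom_monic hD n).map _).ne_zero h

theorem periodicPoly_monic (hD : 2 ≤ D) {n : ℕ} (hn : 0 < n) : (periodicPoly D n).Monic := by
  refine monic_of_injective (RingHom.injective_int (Int.castRingHom ℂ)) ?_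
  rw [map_periodicPoly hD hn]
  exact exactCenterPoly_monic n

theorem aeval_periodicPoly_eq_zero (hD : 2 ≤ D) {n : ℕ} (hn : 0 < n) {b : ℂ}
    (h : Function.minimalPeriod (unicritical D b) 0 = n) : aeval b (periodicPoly D n) = 0 := by
  rw [← eval_map_intCast, map_periodicPoly hD hn, exactCenterPoly, eval_prod,
    Finset.prod_eq_zero_iff]
  exact ⟨b, Finset.mem_filter.2 ⟨(mem_centers hD hn).2 h.dvd, h⟩, by simp⟩

theorem periodicPoly_dvd (hD : 2 ≤ D) {n : ℕ} (hn : 0 < n) :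
    periodicPoly D n ∣ critOrbitPoly D n := by
  refine dvd_of_map_intCast_dvd (periodicPoly_monic hD hn) ?_
  rw [map_periodicPoly hD hn, map_critOrbitPoly_eq_prod hD hn]
  exact Finset.prod_dvd_prod_of_subset _ _ _ (Finset.filter_subset _ _)

theorem periodicPoly_mul_dvd (hD : 2 ≤ D) {m n : ℕ} (hn : 0 < n) (hm : m ∣ n) (hmn : m < n) :
    periodicPoly D n * critOrbitPoly D m ∣ critOrbitPoly D n := by
  classical
  have hm0 : 0 < m := Nat.pos_of_dvd_of_pos hm hn
  refine dvd_of_map_intCast_dvd ((periodicPoly_monic hD hn).mul (critOrbitPoly_monic hD hm0)) ?_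
  rw [Polynomial.map_mul, map_periodicPoly hD hn, map_critOrbitPoly_eq_prod hD hn,
    map_critOrbitPoly_eq_prod hD hm0, exactCenterPoly, ← Finset.prod_union]
  · refine Finset.prod_dvd_prod_of_subset _ _ _ (Finset.union_subset (Finset.filter_subset _ _) ?_)
    intro b hb
    rw [mem_centers hD hm0] at hb
    exact (mem_centers hD hn).2 (hb.trans hm)
  · refine Finset.disjoint_left.2 fun b hb hb' => ?_
    rw [mem_centers hD hm0, (Finset.mem_filter.1 hb).2] at hb'
    exact absurd (Nat.le_of_dvd hm0 hb') (by omega)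

end Periodic

/-! ### Reduction modulo `p` -/

section Reduction

variable {p e D : ℕ}

/-- Reduction modulo `p` of integer polynomials. -/
noncomputable abbrev reduce (p : ℕ) : ℤ[X] →+* (ZMod p)[X] := mapRingHom (Int.castRingHom (ZMod p))

theorem reduce_critOrbitPoly_add (m n : ℕ) :
    reduce p (critOrbitPoly D (m + n)) = (unicritical D X)^[m] (reduce p (critOrbitPoly D n)) := by
  rw [critOrbitPoly_add, map_iterate_unicritical]; simp

theorem not_sq_dvd_reduce_critOrbitPoly [Fact p.Prime] (hpD : p ∣ D) {n : ℕ} (hn : 1 ≤ n)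
    {q : (ZMod p)[X]} (hq : ¬ IsUnit q) : ¬ q * q ∣ reduce p (critOrbitPoly D n) := by
  intro h
  obtain ⟨s, hs⟩ := dvd_X_mul_derivative_critOrbitPoly (D := D) hn
  have h1 := congrArg (reduce p) hs
  have hD0 : reduce p (D : ℤ[X]) = 0 := by
    rw [map_natCast, CharP.cast_eq_zero_iff (ZMod p)[X] p]
    exact hpD
  rw [map_mul, hD0, zero_mul, map_add, map_sub, map_mul, map_one] at h1
  have h2 : reduce p (derivative (critOrbitPoly D n)) = derivative (reduce p (critOrbitPoly D n)) :=
    (derivative_map _ _).symm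
  rw [h2] at h1
  have hq1 : q ∣ reduce p (critOrbitPoly D n) := (Dvd.intro _ rfl).trans h
  have hq2 : q ∣ derivative (reduce p (critOrbitPoly D n)) := by
    obtain ⟨v, hv⟩ := h
    rw [hv]
    exact ⟨derivative q * v + derivative (q * v), by simp only [derivative_mul]; ring⟩
  have h3 : q ∣ 1 := by
    have h4 := (dvd_sub (hq2.mul_left (reduce p X)) hq1)
    exact (dvd_add_right h4).1 (h1 ▸ dvd_zero q)
  exact hq (isUnit_of_dvd_one h3)

/-- Modulo `p` one has `S_{k,n,d} = X ^ N * P_n ^ M` with exponents independent of `n`. -/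
theorem reduce_orbitRelationPoly [Fact p.Prime] (hD : D = p ^ e) (j l : ℕ) :
    ∃ N M : ℕ, ∀ n : ℕ,
      reduce p (orbitRelationPoly D p j l n) = X ^ N * reduce p (critOrbitPoly D n) ^ M := by
  obtain ⟨N, hN⟩ := iterate_sub_of_charP (A := (ZMod p)[X]) p e hD X l
  refine ⟨N * (p ^ j * (p - 1)), D ^ l * (p ^ j * (p - 1)), fun n => ?_⟩
  have h0 := reduce_critOrbitPoly_add (p := p) (D := D) l 0
  rw [orbitRelationPoly, map_cyclotomicForm, cyclotomicForm_of_charP, reduce_critOrbitPoly_add,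
    ← add_zero l, h0, add_zero, hN]
  rw [show critOrbitPoly D 0 = 0 from rfl, map_zero, sub_zero, mul_pow, ← pow_mul, ← pow_mul]

end Reduction

section ReducedPeriodic

variable {p D n : ℕ}

theorem not_reduce_periodicPoly_dvd [Fact p.Prime] (hpD : p ∣ D) (hD : 2 ≤ D) (hn : 0 < n)
    (hr : Irreducible (reduce p (periodicPoly D n))) {m : ℕ} (hm : m ∣ n) (hmn : m < n) :
    ¬ reduce p (periodicPoly D n) ∣ reduce p (critOrbitPoly D m) := fun h =>
  not_sq_dvd_reduce_critOrbitPoly hpD hn hr.not_isUnit <| (mul_dvd_mul_left _ h).trans <| by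
    rw [← map_mul]; exact _root_.map_dvd (reduce p) (periodicPoly_mul_dvd hD hn hm hmn)

/-- A root of the reduction of `R_n` in characteristic `p` is a parameter for which `0` has exact
period `n`; so it is a root of `P_l` only if `n ∣ l`. -/
theorem dvd_of_reduce_periodicPoly_dvd [Fact p.Prime] (hpD : p ∣ D) (hD : 2 ≤ D) (hn : 0 < n)
    (hr : Irreducible (reduce p (periodicPoly D n))) {l : ℕ}
    (h : reduce p (periodicPoly D n) ∣ reduce p (critOrbitPoly D l)) : n ∣ l := by
  set r := reduce p (periodicPoly D n) with hr'
  set x := AdjoinRoot.mk r (reduce p X) with hx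
  have key : ∀ m, r ∣ reduce p (critOrbitPoly D m) ↔
      Function.IsPeriodicPt (unicritical D x) m 0 := by
    intro m
    rw [← AdjoinRoot.mk_eq_zero]
    have := map_critOrbitPoly (D := D) ((AdjoinRoot.mk r).comp (reduce p)) m
    rw [RingHom.comp_apply, RingHom.comp_apply] at this
    rw [this]; rfl
  have hn' := (key n).1 (_root_.map_dvd (reduce p) (periodicPoly_dvd hD hn))
  have hl' := (key l).1 h
  set t := Function.minimalPeriod (unicritical D x) 0 with ht
  have htn : t ∣ n := hn'.minimalPeriod_dvd
  have htr : r ∣ reduce p (critOrbitPoly D t) := (key t).2 (Function.isPeriodicPt_minimalPeriod _ _)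
  rcases (Nat.le_of_dvd hn htn).lt_or_eq with h1 | h1
  · exact absurd htr (not_reduce_periodicPoly_dvd hpD hD hn hr htn h1)
  · exact h1 ▸ hl'.minimalPeriod_dvd

theorem not_reduce_periodicPoly_dvd_X [Fact p.Prime] (hD : 2 ≤ D) (hn : 0 < n)
    (hr : Irreducible (reduce p (periodicPoly D n))) : ¬ reduce p (periodicPoly D n) ∣ X := by
  intro h
  have h1 : X ∣ reduce p (critOrbitPoly D n) - 1 := by
    have := _root_.map_dvd (reduce p) (X_dvd_critOrbitPoly_sub_one (D := D) hn)
    simpa using this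
  have h2 : reduce p (periodicPoly D n) ∣ reduce p (critOrbitPoly D n) :=
    _root_.map_dvd (reduce p) (periodicPoly_dvd hD hn)
  exact hr.not_isUnit (isUnit_of_dvd_one ((dvd_sub_right h2).1 (h.trans h1)))

theorem reduce_periodicPoly_dvd_of_irreducible [Fact p.Prime] (hD : 2 ≤ D) (hn : 0 < n)
    (hr : Irreducible (reduce p (periodicPoly D n))) {q : (ZMod p)[X]} (hq : Irreducible q)
    (hqn : q ∣ reduce p (critOrbitPoly D n))
    (hqm : ∀ m, m ∣ n → m < n → ¬ q ∣ reduce p (critOrbitPoly D m)) :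
    reduce p (periodicPoly D n) ∣ q := by
  have h1 : q ∣ reduce p (periodicNum D n) := by
    rw [periodicNum, map_prod]
    refine hqn.trans (Finset.dvd_prod_of_mem _ (Finset.mem_filter.2 ⟨Nat.mem_divisors_self n hn.ne', ?_⟩))
    rw [Nat.div_self hn, ArithmeticFunction.moebius_apply_one]
  rw [← periodicDenom_mul_periodicPoly hD hn, map_mul] at h1
  refine (hq.dvd_symm hr ((hq.prime.dvd_or_dvd h1).resolve_left ?_))
  rw [periodicDenom, map_prod, hq.prime.dvd_finsetProd_iff]
  rintro ⟨m, hm, hdvd⟩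
  obtain ⟨hm1, hm2⟩ := Finset.mem_filter.1 hm
  have hmn := Nat.dvd_of_mem_divisors hm1
  refine hqm m hmn ((Nat.le_of_dvd hn hmn).lt_of_ne ?_) hdvd
  rintro rfl
  rw [Nat.div_self hn, ArithmeticFunction.moebius_apply_one] at hm2
  norm_num at hm2

end ReducedPeriodic

/-! ### A generalised Eisenstein criterion -/

section Criterion

variable {p : ℕ}

theorem exists_eq_add_of_reduce_dvd [Fact p.Prime] {r g : ℤ[X]} (h : reduce p r ∣ reduce p g) :
    ∃ u v : ℤ[X], g = (p : ℤ[X]) * u + r * v := by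
  obtain ⟨w, hw⟩ := h
  obtain ⟨v, rfl⟩ := map_surjective (Int.castRingHom (ZMod p)) (ZMod.ringHom_surjective _) w
  have h1 : reduce p (g - r * v) = 0 := by
    rw [map_sub, map_mul, hw, sub_eq_zero]; rfl
  have h2 : (C (p : ℤ)) ∣ g - r * v := by
    rw [C_dvd_iff_dvd_coeff]
    intro i
    rw [← ZMod.intCast_zmod_eq_zero_iff_dvd]
    have := congrArg (fun q => coeff q i) h1
    rwa [coe_mapRingHom, coeff_map, coeff_zero, eq_intCast] at this
  obtain ⟨u, hu⟩ := h2
  refine ⟨u, v, ?_⟩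
  rw [sub_eq_iff_eq_add] at hu
  rw [hu]; simp

/-- If `A = B` modulo `r` and `B` is a unit modulo `(p, r)`, then the value `p * B ^ φ(d)` of the
cyclotomic form modulo `r` is divisible by `p` only once. -/
theorem cyclotomicForm_ne [Fact p.Prime] {r A B : ℤ[X]} (hr : Irreducible (reduce p r))
    (hAB : r ∣ A - B) (hB : ¬ reduce p r ∣ reduce p B) (j : ℕ) (u v : ℤ[X]) :
    cyclotomicForm p j A B ≠ (p : ℤ[X]) ^ 2 * u + r * v := by
  intro h
  obtain ⟨w, hw⟩ := hAB.trans (sub_dvd_cyclotomicForm_sub (p := p) j A B B)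
  rw [cyclotomicForm_self, h] at hw
  set M := p ^ j * (p - 1)
  have hp0 : (p : ℤ[X]) ≠ 0 := Nat.cast_ne_zero.2 (Fact.out : p.Prime).ne_zero
  have hredp : reduce p (p : ℤ[X]) = 0 := by rw [map_natCast, CharP.cast_eq_zero]
  have h1 : r * (v - w) = (p : ℤ[X]) * (B ^ M - p * u) := by linear_combination hw
  have h2 : reduce p (v - w) = 0 := by
    have := congrArg (reduce p) h1
    rw [map_mul, map_mul, hredp, zero_mul] at this
    exact (mul_eq_zero.1 this).resolve_left hr.ne_zero
  obtain ⟨s, t, hs⟩ := exists_eq_add_of_reduce_dvd (p := p) (r := 0) (g := v - w)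
    (by rw [h2]; exact dvd_zero _)
  rw [zero_mul, add_zero] at hs
  rw [hs] at h1
  have h3 : B ^ M - p * u = r * s := mul_left_cancel₀ hp0 (by rw [← h1]; ring)
  have h4 := congrArg (reduce p) h3
  rw [map_sub, map_mul, hredp, zero_mul, sub_zero, map_pow, map_mul] at h4
  exact hB (hr.prime.dvd_of_dvd_pow (Dvd.intro _ h4.symm))

theorem exists_eq_sq_add_of_mul_dvd [Fact p.Prime] {r g h S : ℤ[X]}
    (hg : reduce p r ∣ reduce p g) (hh : reduce p r ∣ reduce p h) (hS : g * h ∣ S) :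
    ∃ u v : ℤ[X], S = (p : ℤ[X]) ^ 2 * u + r * v := by
  obtain ⟨u, v, rfl⟩ := exists_eq_add_of_reduce_dvd hg
  obtain ⟨u', v', rfl⟩ := exists_eq_add_of_reduce_dvd hh
  obtain ⟨w, rfl⟩ := hS
  exact ⟨u * u' * w, (v * (p * u' + r * v') + p * u * v') * w, by ring⟩

theorem isIntegral_of_aeval {S : ℤ[X]} (hS : S.Monic) {b : ℂ} (hb : aeval b S = 0) : IsIntegral ℤ b :=
  ⟨S, hS, hb⟩

/-- An irreducible factor of the reduction of a monic polynomial comes from one of its complex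
roots. -/
theorem exists_root_reduce_minpoly_dvd [Fact p.Prime] {q : (ZMod p)[X]} (hq : Irreducible q) (n : ℕ)
    (S : ℤ[X]) (hn : S.natDegree = n) (hS : S.Monic) (hqS : q ∣ reduce p S) :
    ∃ b : ℂ, aeval b S = 0 ∧ q ∣ reduce p (minpoly ℤ b) := by
  induction n using Nat.strong_induction_on generalizing S with
  | _ n ih =>
    subst hn
    have hdeg : S.natDegree ≠ 0 := by
      intro h0
      rw [hS.natDegree_eq_zero.1 h0, map_one] at hqS
      exact hq.not_isUnit (isUnit_of_dvd_one hqS)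
    obtain ⟨b, hb⟩ := IsAlgClosed.exists_aeval_eq_zero ℂ S
      (fun h => hdeg (natDegree_eq_zero_iff_degree_le_zero.2 h.le))
    have hint := isIntegral_of_aeval hS hb
    obtain ⟨U, hU⟩ := minpoly.isIntegrallyClosed_dvd hint hb
    have hg := minpoly.monic hint
    have hUm : U.Monic := hg.of_mul_monic_left (hU ▸ hS)
    rw [hU, map_mul] at hqS
    rcases hq.prime.dvd_or_dvd hqS with h | h
    · exact ⟨b, hb, h⟩
    · have hlt : U.natDegree < S.natDegree := by
        rw [hU, hg.natDegree_mul hUm]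
        have := minpoly.natDegree_pos hint
        omega
      obtain ⟨c, hc, hc'⟩ := ih _ hlt U rfl hUm h
      exact ⟨c, by rw [hU, map_mul, hc, mul_zero], hc'⟩

theorem minpoly_eq_of_aeval_minpoly_eq_zero {b c : ℂ} (hb : IsIntegral ℤ b)
    (h : aeval c (minpoly ℤ b) = 0) : minpoly ℤ c = minpoly ℤ b := by
  have hc := isIntegral_of_aeval (minpoly.monic hb) h
  have hdvd := minpoly.isIntegrallyClosed_dvd hc h
  have hirr := (minpoly.prime_of_isIntegrallyClosed hb).irreducible
  have hirr' := (minpoly.prime_of_isIntegrallyClosed hc).irreducible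
  exact eq_of_monic_of_associated (minpoly.monic hc) (minpoly.monic hb)
    (hirr'.associated_of_dvd hirr hdvd)

theorem finprod_roots_minpoly {b : ℂ} (hb : IsIntegral ℤ b) {T : Set ℂ}
    (hT : ∀ c, c ∈ T ↔ aeval c (minpoly ℤ b) = 0) :
    IsIntegralIrreducibleOverRat (∏ᶠ a ∈ T, (X - C a)) := by
  have hb' : IsIntegral ℚ b := hb.tower_top
  have hQ : minpoly ℚ b = (minpoly ℤ b).map (Int.castRingHom ℚ) :=
    minpoly.isIntegrallyClosed_eq_field_fractions' ℚ hb
  have hirr := minpoly.irreducible hb'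
  refine ⟨minpoly ℤ b, ?_, hQ ▸ hirr⟩
  set q := (minpoly ℤ b).map (Int.castRingHom ℂ) with hq
  have hm : q.Monic := (minpoly.monic hb).map _
  have hsep : q.Separable := by
    have h1 := hirr.separable.map (f := algebraMap ℚ ℂ)
    rw [hQ, map_map, RingHom.ext_int ((algebraMap ℚ ℂ).comp (Int.castRingHom ℚ)) (Int.castRingHom ℂ)] at h1
    exact h1
  have hset : T = ↑q.roots.toFinset := by
    ext c
    rw [hT, Finset.mem_coe, Multiset.mem_toFinset, mem_roots hm.ne_zero, IsRoot, hq, eval_map_intCast]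
  rw [hset, finprod_mem_coe_finset, Finset.prod, Multiset.toFinset_val,
    (nodup_roots hsep).dedup]
  exact (IsAlgClosed.splits q).eq_prod_roots_of_monic hm

/-- Let `S` be monic and nonzero modulo `(p ^ 2, r)`, where `r` is irreducible modulo `p` and divides
`S` modulo `p`. Then exactly one irreducible factor of `S` is divisible by `r` modulo `p`: two of them
would each contribute a factor `p` to the value of `S` modulo `r`. -/
theorem isIntegralIrreducibleOverRat_of_roots [Fact p.Prime] {r S : ℤ[X]} (hS : S.Monic)
    (hr : Irreducible (reduce p r)) (hrS : reduce p r ∣ reduce p S)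
    (hne : ∀ u v : ℤ[X], S ≠ (p : ℤ[X]) ^ 2 * u + r * v) {T : Set ℂ}
    (hT : ∀ b, b ∈ T ↔ aeval b S = 0 ∧ reduce p r ∣ reduce p (minpoly ℤ b)) :
    IsIntegralIrreducibleOverRat (∏ᶠ a ∈ T, (X - C a)) := by
  obtain ⟨b, hb, hrb⟩ := exists_root_reduce_minpoly_dvd hr _ S rfl hS hrS
  have hint := isIntegral_of_aeval hS hb
  refine finprod_roots_minpoly hint fun c => ?_
  rw [hT]
  constructor
  · rintro ⟨hc, hrc⟩
    obtain ⟨W, hW⟩ := minpoly.isIntegrallyClosed_dvd hint hb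
    rw [hW, map_mul, mul_eq_zero] at hc
    refine hc.resolve_right fun hWc => ?_
    have hintc := isIntegral_of_aeval hS (by rw [hW, map_mul, hWc, mul_zero])
    obtain ⟨u, v, huv⟩ := exists_eq_sq_add_of_mul_dvd hrb hrc (S := S)
      (hW ▸ mul_dvd_mul_left _ (minpoly.isIntegrallyClosed_dvd hintc hWc))
    exact hne u v huv
  · intro hc
    rw [minpoly_eq_of_aeval_minpoly_eq_zero hint hc]
    refine ⟨?_, hrb⟩
    obtain ⟨W, hW⟩ := minpoly.isIntegrallyClosed_dvd hint hb
    rw [hW, map_mul, hc, zero_mul]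

end Criterion

/-! ### Irreducibility of `R_{k,n,d}` -/

section Main

variable {p e D j l n : ℕ}

theorem reduce_dvd_reduce_cyclotomicForm [Fact p.Prime] {r A B : ℤ[X]} (h : r ∣ A - B) (j : ℕ) :
    reduce p r ∣ reduce p (cyclotomicForm p j A B) := by
  have hp : p.Prime := Fact.out
  rw [map_cyclotomicForm, cyclotomicForm_of_charP, ← map_sub]
  exact dvd_pow (_root_.map_dvd (reduce p) h)
    (Nat.mul_pos (pow_pos hp.pos _) (Nat.sub_pos_of_lt hp.one_lt)).ne'

theorem exists_irreducible_dvd_reduce_minpoly [Fact p.Prime] {b : ℂ} (hb : IsIntegral ℤ b) :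
    ∃ q : (ZMod p)[X], Irreducible q ∧ q ∣ reduce p (minpoly ℤ b) := by
  have hm : (reduce p (minpoly ℤ b)).Monic := (minpoly.monic hb).map _
  refine WfDvdMonoid.exists_irreducible_factor (fun hu => ?_) hm.ne_zero
  have h1 : (reduce p (minpoly ℤ b)).natDegree = (minpoly ℤ b).natDegree :=
    (minpoly.monic hb).natDegree_map _
  rw [natDegree_eq_zero_of_isUnit hu] at h1
  exact (minpoly.natDegree_pos hb).ne h1

theorem iterate_eq_zero_of_orbitRelation (hd : p ^ (j + 1) ∣ D) (hD : D ≠ 0) {b : ℂ}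
    (h : aeval b (orbitRelationPoly D p j l n) = 0) (h0 : (unicritical D b)^[l] 0 = 0) :
    (unicritical D b)^[n] 0 = 0 := by
  rw [aeval_orbitRelationPoly, h0, add_comm, Function.iterate_add_apply, h0] at h
  have h1 := cyclotomicForm_dvd_pow_sub_pow j hd ((unicritical D b)^[n] 0) 0
  rw [h, zero_dvd_iff, zero_pow hD, sub_zero] at h1
  exact eq_zero_of_pow_eq_zero h1

/-- For period `1` the polynomial `S_{k,1,d}` itself is Eisenstein at `p`. -/
theorem isIntegralIrreducibleOverRat_period_one [Fact p.Prime] (he : 1 ≤ e) (hD : D = p ^ e)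
    (hd : p ^ (j + 1) ∣ D) (hl : 1 ≤ l) :
    IsIntegralIrreducibleOverRat (preperiodicPoly D (l + 1) 1 (p ^ (j + 1))) := by
  have hp : p.Prime := Fact.out
  have hD2 : 2 ≤ D := hD ▸ Nat.one_lt_pow (by omega) hp.one_lt
  have hredX : reduce p X = X := by simp
  have hAB : (X : ℤ[X]) ∣ critOrbitPoly D (l + 1) - critOrbitPoly D l := by
    simpa using dvd_sub (X_dvd_critOrbitPoly_sub_one (D := D) (n := l + 1) (by omega))
      (X_dvd_critOrbitPoly_sub_one (D := D) hl)
  have hB : ¬ reduce p X ∣ reduce p (critOrbitPoly D l) := by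
    intro h
    have h1 := _root_.map_dvd (reduce p) (X_dvd_critOrbitPoly_sub_one (D := D) hl)
    rw [map_sub, map_one, dvd_sub_right h, hredX] at h1
    exact irreducible_X.not_isUnit (isUnit_of_dvd_one h1)
  have hr : Irreducible (reduce p X) := hredX ▸ irreducible_X
  have hS := orbitRelationPoly_monic (j := j) hD2 hp.one_le hl le_rfl
  refine isIntegralIrreducibleOverRat_of_roots hS hr (reduce_dvd_reduce_cyclotomicForm hAB j)
    (cyclotomicForm_ne hr hAB hB j) fun b => ⟨fun hb => ?_, fun ⟨hb, _⟩ => ?_⟩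
  · have hb0 := aeval_orbitRelationPoly_of_mem hp hl hb
    have hint := isIntegral_of_aeval hS hb0
    refine ⟨hb0, ?_⟩
    obtain ⟨q, hq, hqg⟩ := exists_irreducible_dvd_reduce_minpoly (p := p) hint
    obtain ⟨N, M, hNM⟩ := reduce_orbitRelationPoly hD j l
    have h1 := hqg.trans (_root_.map_dvd (reduce p) (minpoly.isIntegrallyClosed_dvd hint hb0))
    rw [hNM, critOrbitPoly_one (by omega), map_one, one_pow, mul_one, ← hredX] at h1
    exact (hq.dvd_symm hr (hq.prime.dvd_of_dvd_pow h1)).trans hqg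
  · have h0 : (unicritical D b)^[l] 0 ≠ 0 := by
      intro h0
      have := iterate_eq_zero_of_orbitRelation hd (by omega) hb h0
      simp [unicritical, show D ≠ 0 by omega] at this
    obtain ⟨m, hm, -, hbm⟩ := exists_mem_preperiodicParams hp hd le_rfl hb h0
    rwa [Nat.dvd_one.1 hm] at hbm

/-- Modulo `p`, an irreducible factor of the minimal polynomial of a parameter of preperiod `k` and
period `n` divides `P_n`, but it divides no `P_m` with `m` a proper divisor of `n`: the factor
`S_{k,m,d}` of `S_{k,n,d}` already accounts for all factors of `P_m`. So it can only be `R_n`. -/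
theorem reduce_periodicPoly_dvd_reduce_minpoly [Fact p.Prime] (hD : D = p ^ e) (hpD : p ∣ D)
    (hD2 : 2 ≤ D) (hd : p ^ (j + 1) ∣ D) (hl : 1 ≤ l) (hn : 2 ≤ n)
    (hr : Irreducible (reduce p (periodicPoly D n))) {b : ℂ}
    (hb : b ∈ preperiodicParams D (l + 1) n (p ^ (j + 1))) :
    reduce p (periodicPoly D n) ∣ reduce p (minpoly ℤ b) := by
  have hp : p.Prime := Fact.out
  have hb0 := aeval_orbitRelationPoly_of_mem hp hl hb
  have hint := isIntegral_of_aeval (orbitRelationPoly_monic hD2 hp.one_le hl (by omega)) hb0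
  obtain ⟨q, hq, hqg⟩ := exists_irreducible_dvd_reduce_minpoly (p := p) hint
  refine dvd_trans ?_ hqg
  obtain ⟨N, M, hNM⟩ := reduce_orbitRelationPoly hD j l
  have hmon : ∀ m, 1 ≤ m → (reduce p (critOrbitPoly D m)).Monic := fun m hm =>
    (critOrbitPoly_monic hD2 hm).map _
  have key : ∀ m, m ∣ n → m < n →
      ∃ V, reduce p (critOrbitPoly D n) = reduce p (critOrbitPoly D m) * V ∧ q ∣ V := by
    intro m hmn hlt
    have hm : 1 ≤ m := Nat.pos_of_dvd_of_pos hmn (by omega)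
    obtain ⟨U, hU⟩ := orbitRelationPoly_dvd (p := p) (l := l) hd hm (by omega : 1 ≤ n) hmn
    obtain ⟨V, hV⟩ := critOrbitPoly_dvd (D := D) hmn
    refine ⟨reduce p V, by rw [hV, map_mul], ?_⟩
    have hUb : aeval b U = 0 := by
      rw [hU, map_mul] at hb0
      exact (mul_eq_zero.1 hb0).resolve_left
        (aeval_orbitRelationPoly_ne_zero_of_mem hd hb hm hlt)
    have h1 := congrArg (reduce p) hU
    rw [map_mul, hNM, hNM, hV, map_mul, mul_assoc] at h1
    have h2 := mul_left_cancel₀ (pow_ne_zero N X_ne_zero) h1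
    rw [mul_pow] at h2
    have h3 := mul_left_cancel₀ (pow_ne_zero M (hmon m hm).ne_zero) h2
    refine hq.prime.dvd_of_dvd_pow (n := M) ?_
    rw [h3]
    exact hqg.trans (_root_.map_dvd (reduce p) (minpoly.isIntegrallyClosed_dvd hint hUb))
  refine reduce_periodicPoly_dvd_of_irreducible hD2 (by omega) hr hq ?_ fun m hmn hlt h => ?_
  · obtain ⟨V, hV, hqV⟩ := key 1 (one_dvd n) (by omega)
    rw [hV]
    exact hqV.mul_left _
  · obtain ⟨V, hV, hqV⟩ := key m hmn hlt
    exact not_sq_dvd_reduce_critOrbitPoly hpD (by omega : 1 ≤ n) hq.not_isUnit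
      (hV ▸ mul_dvd_mul h hqV)

/-- Dividing `P_{l + n}` and `P_l` by their common factor `ρ = R_n` if `n ∣ l`, and by `ρ = 1` otherwise,
makes `P_l / ρ` prime to `R_n` modulo `p`. -/
theorem exists_factor_critOrbitPoly [Fact p.Prime] (hpD : p ∣ D) (hD2 : 2 ≤ D) (hl : 1 ≤ l)
    (hn : 0 < n) (hr : Irreducible (reduce p (periodicPoly D n))) :
    ∃ ρ A B : ℤ[X], ρ.Monic ∧ ρ ∣ periodicPoly D n ∧ critOrbitPoly D (l + n) = ρ * A ∧
      critOrbitPoly D l = ρ * B ∧ ¬ reduce p (periodicPoly D n) ∣ reduce p B := by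
  by_cases h : n ∣ l
  · have hdvd := periodicPoly_dvd hD2 hn
    obtain ⟨A, hA⟩ := hdvd.trans (critOrbitPoly_dvd (dvd_add h dvd_rfl))
    obtain ⟨B, hB⟩ := hdvd.trans (critOrbitPoly_dvd h)
    refine ⟨_, A, B, periodicPoly_monic hD2 hn, dvd_rfl, hA, hB, fun h1 => ?_⟩
    refine not_sq_dvd_reduce_critOrbitPoly hpD hl hr.not_isUnit ?_
    rw [hB, map_mul]
    exact mul_dvd_mul_left _ h1
  · exact ⟨1, _, _, monic_one, one_dvd _, (one_mul _).symm, (one_mul _).symm,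
      fun h1 => h (dvd_of_reduce_periodicPoly_dvd hpD hD2 hn hr h1)⟩

theorem isIntegralIrreducibleOverRat_of_irreducible [Fact p.Prime] (he : 1 ≤ e) (hD : D = p ^ e)
    (hd : p ^ (j + 1) ∣ D) (hl : 1 ≤ l) (hn : 2 ≤ n)
    (hr : Irreducible (reduce p (periodicPoly D n))) :
    IsIntegralIrreducibleOverRat (preperiodicPoly D (l + 1) n (p ^ (j + 1))) := by
  have hp : p.Prime := Fact.out
  have hD2 : 2 ≤ D := hD ▸ Nat.one_lt_pow (by omega) hp.one_lt
  have hpD : p ∣ D := hD ▸ dvd_pow_self p (by omega)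
  have hn0 : 0 < n := by omega
  have hrm := periodicPoly_monic hD2 hn0
  obtain ⟨ρ, A, B, hρ, ⟨σ, hσ⟩, hA, hB, hrB⟩ := exists_factor_critOrbitPoly hpD hD2 hl hn0 hr
  have hAB : periodicPoly D n ∣ A - B := by
    obtain ⟨w, hw⟩ := (pow_dvd_pow_of_dvd (periodicPoly_dvd hD2 hn0) 2).trans
      (critOrbitPoly_sq_dvd hD2 hl n)
    refine ⟨σ * w, mul_left_cancel₀ hρ.ne_zero ?_⟩
    rw [mul_sub, ← hA, ← hB, hw]
    linear_combination periodicPoly D n * w * hσ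
  have hS : orbitRelationPoly D p j l n = ρ ^ (p ^ j * (p - 1)) * cyclotomicForm p j A B := by
    rw [orbitRelationPoly, hA, hB, cyclotomicForm_mul]
  have hSm := orbitRelationPoly_monic (j := j) hD2 hp.one_le hl hn0
  have hS'm : (cyclotomicForm p j A B).Monic := (hρ.pow _).of_mul_monic_left (hS ▸ hSm)
  have hne := cyclotomicForm_ne hr hAB hrB j
  refine isIntegralIrreducibleOverRat_of_roots hS'm hr (reduce_dvd_reduce_cyclotomicForm hAB j)
    hne fun b => ⟨fun hb => ?_, fun ⟨hb', hrb⟩ => ?_⟩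
  · refine ⟨?_, reduce_periodicPoly_dvd_reduce_minpoly hD hpD hD2 hd hl hn hr hb⟩
    have hb0 := aeval_orbitRelationPoly_of_mem hp hl hb
    rw [hS, map_mul, map_pow] at hb0
    refine (mul_eq_zero.1 hb0).resolve_left (pow_ne_zero _ fun hρb => ?_)
    refine iterate_ne_zero_of_mem_preperiodicParams (by omega) hb hn0 ?_
    obtain ⟨w, hw⟩ := periodicPoly_dvd hD2 hn0
    rw [← aeval_critOrbitPoly, hw, hσ, map_mul, map_mul, hρb, zero_mul, zero_mul]
  · have hint := isIntegral_of_aeval hS'm hb'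
    have hdvd : ∀ {q : ℤ[X]}, aeval b q = 0 → reduce p (periodicPoly D n) ∣ reduce p q :=
      fun hq => hrb.trans (_root_.map_dvd (reduce p) (minpoly.isIntegrallyClosed_dvd hint hq))
    have hb0 : aeval b (orbitRelationPoly D p j l n) = 0 := by rw [hS, map_mul, hb', mul_zero]
    by_cases h0 : (unicritical D b)^[l] 0 = 0
    · exfalso
      have hper : Function.IsPeriodicPt (unicritical D b) n 0 :=
        iterate_eq_zero_of_orbitRelation hd (by omega) hb0 h0
      rcases (Nat.le_of_dvd hn0 hper.minimalPeriod_dvd).lt_or_eq with hlt | heq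
      · refine not_reduce_periodicPoly_dvd hpD hD2 hn0 hr hper.minimalPeriod_dvd hlt (hdvd ?_)
        rw [aeval_critOrbitPoly]
        exact Function.isPeriodicPt_minimalPeriod _ _
      · -- The minimal polynomial of `b` is then `R_n`, but `R_n` does not divide the cyclotomic form.
        obtain ⟨U, hU⟩ := minpoly.isIntegrallyClosed_dvd hint (aeval_periodicPoly_eq_zero hD2 hn0 heq)
        have hg := minpoly.monic hint
        have hUm : U.Monic := hg.of_mul_monic_left (hU ▸ hrm)
        have hdeg : (periodicPoly D n).natDegree ≤ (minpoly ℤ b).natDegree := by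
          have h1 : (reduce p (periodicPoly D n)).natDegree = (periodicPoly D n).natDegree :=
            hrm.natDegree_map _
          have h2 : (reduce p (minpoly ℤ b)).natDegree = (minpoly ℤ b).natDegree :=
            hg.natDegree_map _
          rw [← h1, ← h2]
          exact natDegree_le_of_dvd hrb (hg.map _).ne_zero
        rw [hU, hg.natDegree_mul hUm] at hdeg
        have hU1 : U = 1 := hUm.natDegree_eq_zero.1 (by omega)
        rw [hU1, mul_one] at hU
        obtain ⟨v, hv⟩ := minpoly.isIntegrallyClosed_dvd hint hb'
        exact hne 0 v (by rw [mul_zero, zero_add, hU, hv])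
    · obtain ⟨m, hmn, hm, hbm⟩ := exists_mem_preperiodicParams hp hd hn0 hb0 h0
      rcases (Nat.le_of_dvd hn0 hmn).lt_or_eq with hlt | rfl
      · exfalso
        have h1 := hdvd (aeval_orbitRelationPoly_of_mem hp hl hbm)
        obtain ⟨N, M, hNM⟩ := reduce_orbitRelationPoly hD j l
        rw [hNM] at h1
        rcases hr.prime.dvd_or_dvd h1 with h2 | h2
        · exact not_reduce_periodicPoly_dvd_X hD2 hn0 hr (hr.prime.dvd_of_dvd_pow h2)
        · exact not_reduce_periodicPoly_dvd hpD hD2 hn0 hr hmn hlt (hr.prime.dvd_of_dvd_pow h2)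
      · exact hbm

end Main

theorem mainTheorem3 (p e D : ℕ) (hp : p.Prime) (he : 1 ≤ e) (hD : D = p ^ e) :
    (∀ k d : ℕ, 2 ≤ k → 2 ≤ d → d ∣ D →
      IsIntegralIrreducibleOverRat (preperiodicPoly D k 1 d)) ∧
    (∀ n : ℕ, 2 ≤ n → Irreducible ((periodicPoly D n).map (Int.castRingHom (ZMod p))) →
      ∀ k d : ℕ, 2 ≤ k → 2 ≤ d → d ∣ D →
        IsIntegralIrreducibleOverRat (preperiodicPoly D k n d)) := by
  have : Fact p.Prime := ⟨hp⟩
  have hd : ∀ d : ℕ, 2 ≤ d → d ∣ D → ∃ j, d = p ^ (j + 1) := by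
    intro d hd2 hdD
    obtain ⟨i, -, rfl⟩ := (Nat.dvd_prime_pow hp).1 (hD ▸ hdD)
    rcases i with _ | j
    · simp at hd2
    · exact ⟨j, rfl⟩
  have hk : ∀ k : ℕ, 2 ≤ k → ∃ l, 1 ≤ l ∧ k = l + 1 := fun k hk => ⟨k - 1, by omega, by omega⟩
  constructor
  · intro k d hk2 hd2 hdD
    obtain ⟨j, rfl⟩ := hd d hd2 hdD
    obtain ⟨l, hl, rfl⟩ := hk k hk2
    exact isIntegralIrreducibleOverRat_period_one he hD hdD hl
  · intro n hn hr k d hk2 hd2 hdD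
    obtain ⟨j, rfl⟩ := hd d hd2 hdD
    obtain ⟨l, hl, rfl⟩ := hk k hk2
    exact isIntegralIrreducibleOverRat_of_irreducible he hD hdD hl hn hr
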